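/- All rings are integral domains. Call an ideal of a domain $D$ with quotient field $K$ *invertible* if it is invertible as a fractional ideal, and call an ideal an *MNI ideal* if it is maximal among the non-invertible ideals of $D$. The domain $D$ is an *MPD domain* if it has a unique MNI ideal $Q$ and every nonzero non-invertible ideal of $D$ is of the form $JQ$ with $J$ an invertible ideal of $D$. It is *h-local* if every nonzero ideal is contained in only finitely many maximal ideals and every nonzero prime ideal is contained in a unique maximal ideal. It is a *GMPD domain* (globalized multiplicatively pinched-Dedekind domain) if it is h-local and $D_M$ is an MPD domain for every maximal ideal $M$ of $D$. An *overring* of $D$ is a subring of $K$ containing $D$. A *Prüfer domain* is a domain in which every nonzero finitely generated ideal is invertible. Let $D$ be a GMPD domain with only finitely many overrings. Then there exists a Prüfer domain $R$ such that $\operatorname{Spec}(D)$ and $\operatorname{Spec}(R)$, ordered by inclusion, are isomorphic as partially ordered sets; that is, there is an order-preserving bijection $\operatorname{Spec}(D)\to\operatorname{Spec}(R)$ whose inverse is also order-preserving. -/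

import Mathlib

universe u

namespace PinchedDomain

/-- An ideal of `R` is invertible if it is a unit in the monoid of fractional ideals of `R`
(in the total fraction ring, which is the quotient field when `R` is a domain). -/
def IsInvertible {R : Type u} [CommRing R] (I : Ideal R) : Prop :=
  IsUnit (I : FractionalIdeal (nonZeroDivisors R) (FractionRing R))

/-- An MNI ideal: an ideal maximal among the non-invertible ideals. -/
def IsMNI {R : Type u} [CommRing R] (Q : Ideal R) : Prop :=
  Maximal (fun I : Ideal R => ¬ IsInvertible I) Q

/-- Multiplicatively pinched-Dedekind: there is a unique MNI ideal `Q`, and every nonzero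
non-invertible ideal is of the form `J * Q` with `J` an invertible ideal. -/
def IsMPD (R : Type u) [CommRing R] : Prop :=
  ∃ Q : Ideal R, IsMNI Q ∧ (∀ Q' : Ideal R, IsMNI Q' → Q' = Q) ∧
    ∀ I : Ideal R, I ≠ ⊥ → ¬ IsInvertible I → ∃ J : Ideal R, IsInvertible J ∧ I = J * Q

/-- h-local: every nonzero ideal is contained in only finitely many maximal ideals, and every
nonzero prime ideal is contained in a unique maximal ideal. -/
def IsHLocal (R : Type u) [CommRing R] : Prop :=
  (∀ I : Ideal R, I ≠ ⊥ → {M : Ideal R | M.IsMaximal ∧ I ≤ M}.Finite) ∧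
    ∀ P : Ideal R, P.IsPrime → P ≠ ⊥ → ∃! M : Ideal R, M.IsMaximal ∧ P ≤ M

/-- Globalized multiplicatively pinched-Dedekind: h-local, with all localizations at maximal
ideals MPD. -/
def IsGMPD (R : Type u) [CommRing R] : Prop :=
  IsHLocal R ∧ ∀ (M : Ideal R) [M.IsMaximal], IsMPD (Localization.AtPrime M)

/-- The overrings of a domain `R`: the subrings of its quotient field that contain `R`. -/
abbrev Overring (R : Type u) [CommRing R] : Type u :=
  Subalgebra R (FractionRing R)

/-- The Prüfer condition on a domain: every nonzero finitely generated ideal is invertible. -/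
def IsPrufer (R : Type u) [CommRing R] : Prop :=
  ∀ I : Ideal R, I ≠ ⊥ → I.FG → IsInvertible I

end PinchedDomain

/-! Spec(D) is a zero prime with finitely many disjoint branches above it, each a chain of one or
two primes, and every such poset is realised by an intersection of valuation rings. In a local MPD
domain every nonzero ideal is principal or of the form zQ, which leaves only Q and the maximal ideal
as possible nonzero primes (`IsMPD.exists_forall_prime`). h-locality keeps the branches disjoint
(`IsGMPD.exists_isBranched`), and the overrings D_M are pairwise distinct, so there are finitely
many branches. Conversely, in F(t)(X) with F infinite, take for each branch the functions defined at
a point X = a_i, with value in F(t) unrestricted (one prime) or defined at t = 0 (two primes). Their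
intersection is Bezout, because a + ub divides a and b for all but finitely many u in F, and each of
its nonzero primes comes from a single valuation ring (`exists_forall_div_mem`,
`isBranched_center`). -/

namespace PinchedDomain

/-- A poset with bottom consisting of disjoint branches above the bottom, the branch at `i`
being `q i ≤ m i`. -/
structure IsBranched {ι A : Type*} [PartialOrder A] [OrderBot A] (q m : ι → A) : Prop where
  le (i : ι) : q i ≤ m i
  ne_bot (i : ι) : q i ≠ ⊥
  eq_of_le {i j : ι} : q i ≤ m j → i = j
  cases (a : A) : a = ⊥ ∨ (∃ i, a = q i) ∨ ∃ i, a = m i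

/-! ### Isomorphisms of branched posets. -/

namespace IsBranched

variable {ι A B : Type*} [PartialOrder A] [OrderBot A] [PartialOrder B] [OrderBot B]
  {q m : ι → A} {q' m' : ι → B}

/-- The map is defined by testing for some `q i` before `m i`, so a collapsed branch must have a
collapsed target. -/
theorem exists_orderHom (h : IsBranched q m) (h' : IsBranched q' m')
    (hqm : ∀ i, q i = m i → q' i = m' i) :
    ∃ g : A →o B, g ⊥ = ⊥ ∧ (∀ i, g (q i) = q' i) ∧ ∀ i, g (m i) = m' i := by
  classical
  let g : A → B := fun a =>
    if hq : ∃ i, a = q i then q' hq.choose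
    else if hm : ∃ i, a = m i then m' hm.choose else ⊥
  have hgq (i) : g (q i) = q' i := by
    have hq : ∃ j, q i = q j := ⟨i, rfl⟩
    have : i = hq.choose := h.eq_of_le (hq.choose_spec.le.trans (h.le _))
    simp only [g, dif_pos hq]
    rw [← this]
  have hgm (i) : g (m i) = m' i := by
    by_cases hi : q i = m i
    · rw [← hi, hgq, hqm i hi]
    · have hq : ¬ ∃ j, m i = q j := by
        rintro ⟨j, hj⟩
        obtain rfl : j = i := h.eq_of_le hj.ge
        exact hi hj.symm
      have hm : ∃ j, m i = m j := ⟨i, rfl⟩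
      have : i = hm.choose := h.eq_of_le ((h.le i).trans hm.choose_spec.le)
      simp only [g, dif_neg hq, dif_pos hm]
      rw [← this]
  have hgb : g ⊥ = ⊥ := by
    have hq : ¬ ∃ j, (⊥ : A) = q j := fun ⟨j, hj⟩ => h.ne_bot j hj.symm
    have hm : ¬ ∃ j, (⊥ : A) = m j := fun ⟨j, hj⟩ => h.ne_bot j (le_bot_iff.1 (hj ▸ h.le j))
    simp only [g, dif_neg hq, dif_neg hm]
  refine ⟨⟨g, fun a b hab => ?_⟩, hgb, hgq, hgm⟩
  rcases h.cases a with rfl | ⟨i, rfl⟩ | ⟨i, rfl⟩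
  · rw [hgb]
    exact bot_le
  · rcases h.cases b with rfl | ⟨j, rfl⟩ | ⟨j, rfl⟩
    · exact (h.ne_bot i (le_bot_iff.1 hab)).elim
    · rw [h.eq_of_le (hab.trans (h.le j))]
    · rw [h.eq_of_le hab, hgq, hgm]
      exact h'.le j
  · rcases h.cases b with rfl | ⟨j, rfl⟩ | ⟨j, rfl⟩
    · exact (h.ne_bot i (le_bot_iff.1 ((h.le i).trans hab))).elim
    · obtain rfl := h.eq_of_le (((h.le i).trans hab).trans (h.le j))
      rw [le_antisymm hab (h.le i)]
    · rw [h.eq_of_le ((h.le i).trans hab)]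

theorem nonempty_orderIso (h : IsBranched q m) (h' : IsBranched q' m')
    (hqm : ∀ i, q i = m i ↔ q' i = m' i) : Nonempty (A ≃o B) := by
  obtain ⟨f, hfb, hfq, hfm⟩ := h.exists_orderHom h' fun i => (hqm i).1
  obtain ⟨g, hgb, hgq, hgm⟩ := h'.exists_orderHom h fun i => (hqm i).2
  refine ⟨OrderIso.ofHomInv f g ?_ ?_⟩
  · ext b
    rcases h'.cases b with rfl | ⟨i, rfl⟩ | ⟨i, rfl⟩ <;> simp [*]
  · ext a
    rcases h.cases a with rfl | ⟨i, rfl⟩ | ⟨i, rfl⟩ <;> simp [*]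

end IsBranched

/-! ### Primes of local MPD domains. -/

section Local

theorem IsInvertible.top {A : Type u} [CommRing A] : IsInvertible (⊤ : Ideal A) := by
  simp [IsInvertible]

variable {A : Type u} [CommRing A] [IsDomain A]

theorem IsInvertible.ne_bot {I : Ideal A} (hI : IsInvertible I) : I ≠ ⊥ := by
  rintro rfl
  simp [IsInvertible] at hI

theorem IsInvertible.span_singleton {x : A} (hx : x ≠ 0) : IsInvertible (Ideal.span {x}) := by
  have hx' : algebraMap A (FractionRing A) x ≠ 0 := by simpa using hx
  rw [IsInvertible, FractionalIdeal.coeIdeal_span_singleton]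
  exact IsUnit.of_mul_eq_one _ (FractionalIdeal.spanSingleton_mul_inv _ hx')

theorem IsInvertible.exists_eq_span [IsLocalRing A] {I : Ideal A} (hI : IsInvertible I) :
    ∃ x, x ≠ 0 ∧ I = Ideal.span {x} := by
  have hf : {I : Ideal A | I.IsMaximal}.Finite :=
    (Set.finite_singleton (IsLocalRing.maximalIdeal A)).subset fun J hJ =>
      IsLocalRing.eq_maximalIdeal hJ
  obtain ⟨x, hx⟩ := (Ideal.IsPrincipal.of_finite_maximals_of_isUnit hf hI).principal
  refine ⟨x, ?_, hx⟩
  rintro rfl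
  exact hI.ne_bot (by simpa using hx)

theorem IsMPD.exists_forall_prime [IsLocalRing A] (hA : IsMPD A) :
    ∃ Q : Ideal A, ∀ P : Ideal A, P.IsPrime → P ≠ ⊥ →
      P = Q ∨ P = IsLocalRing.maximalIdeal A := by
  obtain ⟨Q, hQ, -, hmul⟩ := hA
  have hQtop : Q ≠ ⊤ := by
    rintro rfl
    exact hQ.prop IsInvertible.top
  have key (I : Ideal A) (hI : I ≠ ⊥) :
      (∃ x, x ≠ 0 ∧ I = Ideal.span {x}) ∨ ∃ z, z ≠ 0 ∧ I = Ideal.span {z} * Q := by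
    by_cases h : IsInvertible I
    · exact .inl h.exists_eq_span
    · obtain ⟨J, hJ, rfl⟩ := hmul I hI h
      obtain ⟨z, hz, rfl⟩ := hJ.exists_eq_span
      exact .inr ⟨z, hz, rfl⟩
  refine ⟨Q, fun P hP hP0 => ?_⟩
  by_cases hPQ : P ≤ Q
  · by_contra! hne
    obtain ⟨y, hyQ, hyP⟩ : ∃ y ∈ Q, y ∉ P := by
      by_contra! h
      exact hne.1 (le_antisymm hPQ h)
    rcases key P hP0 with ⟨x, hx0, rfl⟩ | ⟨z, hz0, hz⟩
    · have hxp : Prime x := (Ideal.span_singleton_prime hx0).1 hP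
      have hxQ : x ∈ Q := hPQ (Ideal.mem_span_singleton_self x)
      -- The prime x is irreducible. If the ideal is (d), then d is a unit or an associate of x, and
      -- x would divide y. If it is zQ, then x = zr with r in Q, so z is a unit.
      have pair (y : A) (hyQ : y ∈ Q) (hyx : ¬ x ∣ y) : Ideal.span {x, y} = Q := by
        have hle : Ideal.span {x, y} ≤ Q := by
          rw [Ideal.span_le, Set.insert_subset_iff, Set.singleton_subset_iff]
          exact ⟨hxQ, hyQ⟩
        have hxm : x ∈ Ideal.span {x, y} := Ideal.subset_span (by simp)
        have hym : y ∈ Ideal.span {x, y} := Ideal.subset_span (by simp)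
        rcases key (Ideal.span {x, y}) (fun h => hx0 (by simpa [h] using hxm)) with
          ⟨d, -, hd⟩ | ⟨z, hz0, hz⟩
        · exfalso
          rw [hd, Ideal.mem_span_singleton] at hxm hym
          rw [hd] at hle
          obtain ⟨e, he⟩ := hxm
          rcases hxp.irreducible.isUnit_or_isUnit he with hu | hu
          · exact hQtop (top_le_iff.1 ((Ideal.span_singleton_eq_top.2 hu).ge.trans hle))
          · apply hyx
            rw [he]
            exact hu.mul_right_dvd.2 hym
        · rw [hz, Ideal.mem_span_singleton_mul] at hxm
          obtain ⟨r, hr, hrx⟩ := hxm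
          rcases hxp.irreducible.isUnit_or_isUnit hrx.symm with hu | hu
          · rw [hz, Ideal.span_singleton_eq_top.2 hu, Ideal.top_mul]
          · exact (hQtop (Ideal.eq_top_of_isUnit_mem _ hr hu)).elim
      rw [Ideal.mem_span_singleton] at hyP
      -- Both (x, y) and (x, y²) equal Q. So x divides y(1 - by), although y is not in (x) and 1 -
      -- by is not in Q.
      have h1 : y ∈ Ideal.span {x, y ^ 2} := by
        rw [pair (y ^ 2) (by rw [pow_two]; exact Q.mul_mem_left _ hyQ)
          fun h => hyP (hxp.dvd_of_dvd_pow h)]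
        exact hyQ
      obtain ⟨a, b, hab⟩ := Ideal.mem_span_pair.1 h1
      have h2 : x ∣ y * (1 - b * y) := ⟨a, by linear_combination -hab⟩
      rcases hxp.dvd_or_dvd h2 with h | h
      · exact hyP h
      · apply hQtop
        have := Q.add_mem (Q.mem_of_dvd h hxQ) (Q.mul_mem_left b hyQ)
        rw [sub_add_cancel] at this
        exact (Ideal.eq_top_iff_one _).2 this
    · have hzP : z ∈ P := by
        have : z * y ∈ P := by
          rw [hz]
          exact Ideal.mem_span_singleton_mul.2 ⟨y, hyQ, rfl⟩
        exact (hP.mem_or_mem this).resolve_right hyP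
      rw [hz, Ideal.mem_span_singleton_mul] at hzP
      obtain ⟨r, hr, hrz⟩ := hzP
      have : r = 1 := mul_left_cancel₀ hz0 (by rw [hrz, mul_one])
      exact hQtop ((Ideal.eq_top_iff_one _).2 (this ▸ hr))
  -- Ideals not inside Q cannot be zQ, so P and the maximal ideal are both principal. An irreducible
  -- generator of P divisible by the non-unit t is associate to t.
  · right
    have hprin (I : Ideal A) (hI : I ≠ ⊥) (hIQ : ¬ I ≤ Q) : ∃ x, x ≠ 0 ∧ I = Ideal.span {x} := by
      rcases key I hI with h | ⟨z, -, hz⟩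
      · exact h
      · exact (hIQ (hz ▸ Ideal.mul_le_right)).elim
    have hle := IsLocalRing.le_maximalIdeal hP.ne_top
    obtain ⟨p, hp0, rfl⟩ := hprin P hP0 hPQ
    obtain ⟨t, -, ht⟩ := hprin (IsLocalRing.maximalIdeal A)
      (fun h => hP0 (le_bot_iff.1 (h ▸ hle))) fun h => hPQ (hle.trans h)
    have hpp : Prime p := (Ideal.span_singleton_prime hp0).1 hP
    rw [ht] at hle ⊢
    rw [Ideal.span_singleton_le_span_singleton] at hle
    obtain ⟨r, hr⟩ := hle
    rcases hpp.irreducible.isUnit_or_isUnit hr with hu | hu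
    · have : t ∈ IsLocalRing.maximalIdeal A := ht ▸ Ideal.mem_span_singleton_self t
      exact ((IsLocalRing.mem_maximalIdeal _).1 this hu).elim
    · rw [Ideal.span_singleton_eq_span_singleton]
      exact ⟨hu.unit⁻¹, by rw [hr, mul_assoc, IsUnit.mul_val_inv, mul_one]⟩

end Local

/-! ### The spectrum of a GMPD domain. -/

section Global

variable {D : Type u} [CommRing D] [IsDomain D]

theorem eq_of_prime_lt_of_isMPD {M P P' : Ideal D} [M.IsMaximal]
    (hM : IsMPD (Localization.AtPrime M)) (hP : P.IsPrime) (hP' : P'.IsPrime) (hP0 : P ≠ ⊥)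
    (hP0' : P' ≠ ⊥) (hlt : P < M) (hlt' : P' < M) : P = P' := by
  obtain ⟨Q, hQ⟩ := hM.exists_forall_prime
  have key (P : Ideal D) (hP : P.IsPrime) (hP0 : P ≠ ⊥) (hlt : P < M) :
      P = Q.comap (algebraMap D (Localization.AtPrime M)) := by
    have hd : Disjoint (M.primeCompl : Set D) P :=
      Set.disjoint_left.2 fun x hx hxP => hx (hlt.le hxP)
    have h1 := IsLocalization.isPrime_of_isPrime_disjoint M.primeCompl
      (Localization.AtPrime M) P hP hd
    have h2 : (P.map (algebraMap D (Localization.AtPrime M))).comap _ = P :=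
      IsLocalization.under_map_of_isPrime_disjoint M.primeCompl (Localization.AtPrime M) hP hd
    have hinj : Function.Injective (algebraMap D (Localization.AtPrime M)) :=
      IsLocalization.injective _ M.primeCompl_le_nonZeroDivisors
    rcases hQ _ h1 (fun h => hP0 ((Ideal.map_eq_bot_iff_of_injective hinj).1 h)) with h | h
    · rw [← h, h2]
    · rw [h] at h2
      exact (hlt.ne (h2.symm.trans
        (IsLocalization.AtPrime.under_maximalIdeal (Localization.AtPrime M) M))).elim
  rw [key P hP hP0 hlt, key P' hP' hP0' hlt']

/-- M is recovered from D_M inside K: for s in N but not in M, 1/s lies in D_M and not in D_N. -/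
theorem finite_maximalSpectrum_of_finite_overring (hfin : Finite (Overring D)) :
    Finite (MaximalSpectrum D) := by
  refine Finite.of_injective (fun M : MaximalSpectrum D =>
    (Localization.subalgebra.ofField (FractionRing D) M.asIdeal.primeCompl
      M.asIdeal.primeCompl_le_nonZeroDivisors : Overring D)) fun M N hMN => ?_
  ext1
  have key : N.asIdeal ≤ M.asIdeal := by
    intro s hs
    by_contra hsM
    have h1 : (algebraMap D (FractionRing D) s)⁻¹ ∈
        Localization.subalgebra.ofField (FractionRing D) M.asIdeal.primeCompl
          M.asIdeal.primeCompl_le_nonZeroDivisors := ⟨1, s, hsM, by simp⟩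
    have hMN' := hMN
    dsimp only at hMN'
    rw [hMN'] at h1
    obtain ⟨a, t, ht, hat⟩ := h1
    have hs0 : s ≠ 0 := by rintro rfl; exact hsM (zero_mem _)
    have ht0 : t ≠ 0 := by rintro rfl; exact ht (zero_mem _)
    have hs0' : algebraMap D (FractionRing D) s ≠ 0 := by simpa using hs0
    have ht0' : algebraMap D (FractionRing D) t ≠ 0 := by simpa using ht0
    field_simp at hat
    rw [← map_mul] at hat
    apply ht
    rw [IsFractionRing.injective D (FractionRing D) hat]
    exact Ideal.mul_mem_right _ _ hs
  exact (N.isMaximal.eq_of_le M.isMaximal.ne_top key).symm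

/-- The nonzero maximal ideals of `D`. -/
abbrev NonzeroMax (D : Type u) [CommRing D] : Type u :=
  {M : MaximalSpectrum D // M.asIdeal ≠ ⊥}

theorem IsGMPD.exists_isBranched (hD : IsGMPD D) :
    ∃ q m : NonzeroMax D → PrimeSpectrum D, IsBranched q m := by
  have hex (M : NonzeroMax D) : ∃ q : PrimeSpectrum D, q ≤ M.1.toPrimeSpectrum ∧ q ≠ ⊥ ∧
      ∀ P : PrimeSpectrum D, P ≤ M.1.toPrimeSpectrum → P ≠ ⊥ →
        P = q ∨ P = M.1.toPrimeSpectrum := by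
    by_cases h : ∃ q : PrimeSpectrum D, q < M.1.toPrimeSpectrum ∧ q ≠ ⊥
    · obtain ⟨q, hq, hq0⟩ := h
      refine ⟨q, hq.le, hq0, fun P hP hP0 => ?_⟩
      rcases hP.eq_or_lt with h | h
      · exact .inr h
      · left
        have := M.1.isMaximal
        ext1
        exact eq_of_prime_lt_of_isMPD (hD.2 M.1.asIdeal) P.isPrime q.isPrime
          (fun h => hP0 (PrimeSpectrum.ext h)) (fun h => hq0 (PrimeSpectrum.ext h)) h hq
    · push Not at h
      -- No nonzero prime lies strictly below M, so the branch collapses and q = m.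
      refine ⟨M.1.toPrimeSpectrum, le_rfl, fun h => M.2 (congrArg PrimeSpectrum.asIdeal h),
        fun P hP hP0 => ?_⟩
      rcases hP.eq_or_lt with h' | h'
      · exact .inr h'
      · exact (hP0 (h P h')).elim
  choose q hle hne hq using hex
  refine ⟨q, fun M => M.1.toPrimeSpectrum, hle, hne, ?_, fun P => ?_⟩
  · intro M N h
    obtain ⟨L, -, hL⟩ := hD.1.2 (q M).asIdeal (q M).isPrime
      fun h => hne M (PrimeSpectrum.ext h)
    apply Subtype.ext
    apply MaximalSpectrum.ext
    exact (hL _ ⟨M.1.isMaximal, hle M⟩).trans (hL _ ⟨N.1.isMaximal, h⟩).symm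
  · by_cases hP0 : P = ⊥
    · exact .inl hP0
    · obtain ⟨M, hM, hPM⟩ := P.asIdeal.exists_le_maximal P.isPrime.ne_top
      have hM0 : M ≠ ⊥ := by
        rintro rfl
        exact hP0 (PrimeSpectrum.ext (le_bot_iff.1 hPM))
      rcases hq ⟨⟨M, hM⟩, hM0⟩ P hPM hP0 with h | h
      · exact .inr (.inl ⟨_, h⟩)
      · exact .inr (.inr ⟨_, h⟩)

end Global

/-! ### Finite intersections of valuation rings over an infinite field. -/

section Intersection

variable {F K : Type*} [Field F] [Field K] [Algebra F K]

theorem valuation_algebraMap_eq_one {V : ValuationSubring K} (hV : ∀ u : F, algebraMap F K u ∈ V)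
    {u : F} (hu : u ≠ 0) : V.valuation (algebraMap F K u) = 1 := by
  have h1 := (V.valuation_le_one_iff _).2 (hV u)
  have h2 := (V.valuation_le_one_iff _).2 (hV u⁻¹)
  have h3 : V.valuation (algebraMap F K u) * V.valuation (algebraMap F K u⁻¹) = 1 := by
    rw [← map_mul, ← map_mul, mul_inv_cancel₀ hu, map_one, map_one]
  refine le_antisymm h1 ?_
  rw [← h3]
  exact mul_le_of_le_one_right' h2

/-- If b/a is in V, u is bad only when 1 + u(b/a) is a non-unit. Two bad u would make b/a a
non-unit, hence 1 as well. If b/a is not in V, then a/b is a non-unit and a/b + u is a unit for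
every nonzero u. -/
theorem finite_setOf_not_common_divisor (V : ValuationSubring K)
    (hV : ∀ u : F, algebraMap F K u ∈ V) {a : K} (ha : a ≠ 0) (b : K) :
    {u : F | ¬ (a + algebraMap F K u * b ≠ 0 ∧ a / (a + algebraMap F K u * b) ∈ V ∧
      b / (a + algebraMap F K u * b) ∈ V)}.Finite := by
  by_cases hz : b / a ∈ V
  · apply Set.Subsingleton.finite
    have hbad (u : F) (hu : ¬ (a + algebraMap F K u * b ≠ 0 ∧ a / (a + algebraMap F K u * b) ∈ V ∧
        b / (a + algebraMap F K u * b) ∈ V)) :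
        V.valuation (1 + algebraMap F K u * (b / a)) < 1 := by
      have hmem : 1 + algebraMap F K u * (b / a) ∈ V := add_mem (one_mem _) (mul_mem (hV u) hz)
      refine lt_of_le_of_ne ((V.valuation_le_one_iff _).2 hmem) fun h => hu ?_
      have h0 : 1 + algebraMap F K u * (b / a) ≠ 0 := by
        intro h0
        simp [h0] at h
      have hinv : (1 + algebraMap F K u * (b / a))⁻¹ ∈ V := by
        rw [← V.valuation_le_one_iff, map_inv₀, h, inv_one]
      have heq : a + algebraMap F K u * b = a * (1 + algebraMap F K u * (b / a)) := by
        field_simp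
      rw [heq]
      refine ⟨mul_ne_zero ha h0, ?_, ?_⟩
      · rwa [div_mul_cancel_left₀ ha]
      · rw [← div_div, div_eq_mul_inv (b / a)]
        exact mul_mem hz hinv
    intro u hu u' hu'
    by_contra hne
    have h1 := hbad u hu
    have h2 := hbad u' hu'
    have h3 : V.valuation (b / a) < 1 := by
      have := V.valuation.map_sub_lt h1 h2
      rwa [show 1 + algebraMap F K u * (b / a) - (1 + algebraMap F K u' * (b / a)) =
        algebraMap F K (u - u') * (b / a) by rw [map_sub]; ring, map_mul,
        valuation_algebraMap_eq_one hV (sub_ne_zero.2 hne), one_mul] at this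
    have h4 : V.valuation (algebraMap F K u * (b / a)) < 1 := by
      rw [map_mul]
      exact (mul_le_of_le_one_left' ((V.valuation_le_one_iff _).2 (hV u))).trans_lt h3
    have := V.valuation.map_sub_lt h1 h4
    rw [add_sub_cancel_right, map_one] at this
    exact lt_irrefl _ this
  · refine (Set.finite_singleton (0 : F)).subset fun u hu => ?_
    by_contra hu0
    have hu0 : u ≠ 0 := hu0
    apply hu
    have hb : b ≠ 0 := by
      rintro rfl
      exact hz (by simp)
    have hab : V.valuation (a / b) < 1 := by
      rw [← V.valuation_le_one_iff, not_le] at hz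
      rw [← inv_div, map_inv₀]
      exact inv_lt_one_of_one_lt₀ hz
    have hv : V.valuation (a / b + algebraMap F K u) = 1 := by
      rw [← valuation_algebraMap_eq_one hV hu0] at hab ⊢
      rw [add_comm]
      exact V.valuation.map_add_eq_of_lt_left hab
    have h0 : a / b + algebraMap F K u ≠ 0 := by
      intro h0
      simp [h0] at hv
    have hinv : (a / b + algebraMap F K u)⁻¹ ∈ V := by
      rw [← V.valuation_le_one_iff, map_inv₀, hv, inv_one]
    have heq : a + algebraMap F K u * b = b * (a / b + algebraMap F K u) := by
      field_simp
    rw [heq]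
    refine ⟨mul_ne_zero hb h0, ?_, ?_⟩
    · rw [← div_div, div_eq_mul_inv (a / b)]
      exact mul_mem ((V.valuation_le_one_iff _).1 hab.le) hinv
    · rwa [div_mul_cancel_left₀ hb]

variable {ι : Type*} (V : ι → ValuationSubring K)

/-- The intersection of a family of valuation rings of a field. -/
abbrev interRing : Subring K := ⨅ i, (V i).toSubring

variable {V}

theorem mem_interRing {x : K} : x ∈ interRing V ↔ ∀ i, x ∈ V i := by
  simp [interRing, Subring.mem_iInf]

theorem exists_common_divisor [Finite ι] [Infinite F] (hV : ∀ i (u : F), algebraMap F K u ∈ V i)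
    {a : K} (ha : a ≠ 0) (b : K) :
    ∃ u : F, a + algebraMap F K u * b ≠ 0 ∧ a / (a + algebraMap F K u * b) ∈ interRing V ∧
      b / (a + algebraMap F K u * b) ∈ interRing V := by
  -- The extra ring `⊤` guarantees a + ub ≠ 0 even when `ι` is empty.
  have hfin := (Set.finite_iUnion fun i => finite_setOf_not_common_divisor (V i) (hV i) ha b).union
    (finite_setOf_not_common_divisor (⊤ : ValuationSubring K) (fun u : F => trivial) ha b)
  obtain ⟨u, hu⟩ := hfin.exists_notMem
  simp only [Set.mem_union, Set.mem_iUnion, Set.mem_ofPred_eq, not_or, not_exists, not_not] at hu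
  exact ⟨u, hu.2.1, mem_interRing.2 fun i => (hu.1 i).2.1, mem_interRing.2 fun i => (hu.1 i).2.2⟩

/-- A pair of elements of an ideal has a nonzero common divisor in the ideal. -/
theorem exists_dvd_of_mem [Finite ι] [Infinite F] (hV : ∀ i (u : F), algebraMap F K u ∈ V i)
    {I : Ideal (interRing V)} {a b : interRing V} (ha0 : a ≠ 0) (ha : a ∈ I) (hb : b ∈ I) :
    ∃ c ∈ I, c ≠ 0 ∧ c ∣ a ∧ c ∣ b := by
  obtain ⟨u, h0, h1, h2⟩ := exists_common_divisor hV (a := (a : K)) (by simpa using ha0) (b : K)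
  let u' : interRing V := ⟨algebraMap F K u, mem_interRing.2 fun i => hV i u⟩
  refine ⟨a + u' * b, I.add_mem ha (I.mul_mem_left _ hb), ?_, ⟨⟨_, h1⟩, ?_⟩, ⟨⟨_, h2⟩, ?_⟩⟩
  · intro h
    exact h0 (congrArg Subtype.val h)
  · apply Subtype.ext
    exact (mul_div_cancel₀ (a : K) h0).symm
  · apply Subtype.ext
    exact (mul_div_cancel₀ (b : K) h0).symm

theorem isBezout_interRing [Finite ι] [Infinite F] (hV : ∀ i (u : F), algebraMap F K u ∈ V i) :
    IsBezout (interRing V) := by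
  rw [IsBezout.iff_span_pair_isPrincipal]
  intro a b
  by_cases ha : a = 0
  · subst ha
    exact ⟨b, by simp⟩
  · obtain ⟨c, hc, -, hca, hcb⟩ := exists_dvd_of_mem hV (I := Ideal.span {a, b}) ha
      (Ideal.subset_span (Set.mem_insert a _))
      (Ideal.subset_span (Set.mem_insert_of_mem _ (Set.mem_singleton b)))
    refine ⟨c, le_antisymm ?_ ?_⟩
    · rw [Ideal.submodule_span_eq, Ideal.span_le, Set.insert_subset_iff, Set.singleton_subset_iff]
      exact ⟨Ideal.mem_span_singleton.2 hca, Ideal.mem_span_singleton.2 hcb⟩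
    · rw [Ideal.submodule_span_eq, Ideal.span_singleton_le_iff_mem]
      exact hc

theorem isPrufer_of_isBezout (R : Type u) [CommRing R] [IsDomain R] [IsBezout R] : IsPrufer R := by
  intro I hI hfg
  obtain ⟨x, hx⟩ := (IsBezout.isPrincipal_of_FG I hfg).principal
  rw [Ideal.submodule_span_eq] at hx
  rw [hx]
  refine IsInvertible.span_singleton ?_
  rintro rfl
  exact hI (by simpa using hx)

/-- Every nonzero prime of the intersection is contracted from one of the valuation rings. -/
theorem exists_forall_div_mem [Finite ι] [Infinite F] (hV : ∀ i (u : F), algebraMap F K u ∈ V i)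
    (P : PrimeSpectrum (interRing V)) (hP : P ≠ ⊥) :
    ∃ i, ∀ s a : interRing V, a ∈ P.asIdeal → a ≠ 0 →
      (s / a : K) ∈ V i → s ∈ P.asIdeal := by
  classical
  by_contra! h
  choose s a ha ha0 hsa hs using h
  obtain ⟨b, hb, hb0⟩ := Submodule.exists_mem_ne_zero_of_ne_bot
    fun h : P.asIdeal = ⊥ => hP (PrimeSpectrum.ext h)
  -- One nonzero c in P dividing every `a i` makes (∏ s_i)/c lie in each `V i`. Then ∏ s_i is in P
  -- although no factor is.
  have hdvd (J : Finset ι) : ∃ c ∈ P.asIdeal, c ≠ 0 ∧ ∀ i ∈ J, c ∣ a i := by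
    induction J using Finset.induction_on with
    | empty => exact ⟨b, hb, hb0, by simp⟩
    | insert j J hj ih =>
      obtain ⟨c, hc, hc0, hcJ⟩ := ih
      obtain ⟨d, hd, hd0, hdc, hda⟩ := exists_dvd_of_mem hV hc0 hc (ha j)
      refine ⟨d, hd, hd0, fun i hi => ?_⟩
      rcases Finset.mem_insert.1 hi with rfl | hi
      · exact hda
      · exact hdc.trans (hcJ i hi)
  have := Fintype.ofFinite ι
  obtain ⟨c, hc, hc0, hca⟩ := hdvd Finset.univ
  have hc0' : (c : K) ≠ 0 := by simpa using hc0
  have hprod : ∏ i, s i ∉ P.asIdeal := by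
    rw [P.isPrime.prod_mem_iff]
    rintro ⟨i, -, hi⟩
    exact hs i hi
  apply hprod
  refine P.asIdeal.mem_of_dvd ⟨⟨((∏ i, s i : interRing V) : K) / c, mem_interRing.2 fun i => ?_⟩,
    Subtype.ext (mul_div_cancel₀ _ hc0').symm⟩ hc
  obtain ⟨r, hr⟩ := hca i (Finset.mem_univ i)
  rw [← Finset.prod_erase_mul _ _ (Finset.mem_univ i)]
  have ha0' : (a i : K) ≠ 0 := by simpa using ha0 i
  have hr' : (a i : K) = c * r := congrArg Subtype.val hr
  have heq : (((∏ j ∈ Finset.univ.erase i, s j) * s i : interRing V) : K) / c =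
      ((∏ j ∈ Finset.univ.erase i, s j : interRing V) : K) * r * (s i / a i) := by
    rw [hr']
    have : (r : K) ≠ 0 := by
      rintro h
      exact ha0' (by rw [hr', h, mul_zero])
    push_cast
    field_simp
  rw [heq]
  exact mul_mem (mul_mem (mem_interRing.1 (Subtype.prop _) i) (mem_interRing.1 r.2 i)) (hsa i)

/-- The contraction of the maximal ideal of a valuation ring containing the intersection. -/
noncomputable def center {O : ValuationSubring K} (h : interRing V ≤ O.toSubring) :
    PrimeSpectrum (interRing V) :=
  PrimeSpectrum.comap (Subring.inclusion h) ⟨IsLocalRing.maximalIdeal O, inferInstance⟩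

theorem mem_center {O : ValuationSubring K} (h : interRing V ≤ O.toSubring) {x : interRing V} :
    x ∈ (center h).asIdeal ↔ (x : K) ∈ O.nonunits := by
  have : (x : K) ∈ O.nonunits ↔ (⟨x, h x.2⟩ : O) ∈ IsLocalRing.maximalIdeal O := by
    rw [ValuationSubring.valuation_lt_one_iff, ValuationSubring.mem_nonunits_iff]
  rw [this]
  rfl

theorem interRing_le (i : ι) : interRing V ≤ (V i).toSubring := iInf_le _ i

theorem interRing_le_of_le {O : ι → ValuationSubring K} (hVO : ∀ i, V i ≤ O i) (i : ι) :
    interRing V ≤ (O i).toSubring := (interRing_le i).trans (hVO i)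

/-- `hpow` forces a nonzero prime coming from `V i` to contain the center of `O i`; `hpow'` excludes
primes strictly between the two centers. The elements `x i`, in the lower center of branch i and
outside the upper center of every other, separate branches. -/
theorem isBranched_center [Finite ι] [Infinite F] (hV : ∀ i (u : F), algebraMap F K u ∈ V i)
    {O : ι → ValuationSubring K} (hVO : ∀ i, V i ≤ O i)
    (hpow : ∀ i, ∀ f ∈ (O i).nonunits, ∀ g ∈ V i, g ≠ 0 → ∃ n : ℕ, f ^ n / g ∈ V i)
    (hpow' : ∀ i, ∀ f ∈ V i, f ∉ (O i).nonunits → ∀ g ∈ (V i).nonunits, ∃ n : ℕ, g ^ n / f ∈ V i)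
    {x : ι → K} (hx0 : ∀ i, x i ≠ 0) (hx : ∀ i j, x i ∈ V j) (hxO : ∀ i, x i ∈ (O i).nonunits)
    (hxV : ∀ i j, i ≠ j → x i ∉ (V j).nonunits) :
    IsBranched (fun i => center (interRing_le_of_le hVO i)) fun i => center (interRing_le i) := by
  have hle (i : ι) : center (interRing_le_of_le hVO i) ≤ center (interRing_le i) := by
    intro f hf
    rw [mem_center] at hf ⊢
    exact ValuationSubring.nonunits_le_nonunits.2 (hVO i) hf
  let y (i : ι) : interRing V := ⟨x i, mem_interRing.2 (hx i)⟩
  have hy (i : ι) : y i ∈ (center (interRing_le_of_le hVO i)).asIdeal :=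
    (mem_center _).2 (hxO i)
  refine ⟨hle, fun i h => ?_, fun {i j} h => ?_, fun P => ?_⟩
  · have := hy i
    rw [h] at this
    exact hx0 i (congrArg Subtype.val (show y i = 0 from this))
  · by_contra hne
    exact hxV i j hne ((mem_center _).1 (h (hy i)))
  · by_cases hP : P = ⊥
    · exact .inl hP
    right
    obtain ⟨i, hi⟩ := exists_forall_div_mem hV P hP
    obtain ⟨b, hb, hb0⟩ := Submodule.exists_mem_ne_zero_of_ne_bot
      fun h : P.asIdeal = ⊥ => hP (PrimeSpectrum.ext h)
    have hqP : center (interRing_le_of_le hVO i) ≤ P := by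
      intro f hf
      obtain ⟨n, hn⟩ := hpow i f ((mem_center _).1 hf) b (mem_interRing.1 b.2 i) (by simpa using hb0)
      exact P.isPrime.mem_of_pow_mem n (hi (f ^ n) b hb hb0 (by simpa using hn))
    have hPm : P ≤ center (interRing_le i) := by
      intro s hs
      by_contra hsm
      rw [mem_center] at hsm
      have hs0 : s ≠ 0 := by
        rintro rfl
        exact hsm (by simp)
      refine P.isPrime.ne_top ((Ideal.eq_top_iff_one _).2 (hi 1 s hs hs0 ?_))
      rw [ValuationSubring.mem_nonunits_iff, not_lt] at hsm
      rw [← ValuationSubring.valuation_le_one_iff]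
      simpa using inv_le_one_of_one_le₀ hsm
    by_cases hPq : P ≤ center (interRing_le_of_le hVO i)
    · exact .inl ⟨i, le_antisymm hPq hqP⟩
    · refine .inr ⟨i, le_antisymm hPm fun g hg => ?_⟩
      obtain ⟨f, hf, hfq⟩ := SetLike.not_le_iff_exists.1
        (show ¬ P.asIdeal ≤ (center (interRing_le_of_le hVO i)).asIdeal from hPq)
      rw [mem_center] at hfq
      have hf0 : f ≠ 0 := by
        rintro rfl
        exact hfq (by simp)
      obtain ⟨n, hn⟩ := hpow' i f (mem_interRing.1 f.2 i) hfq g ((mem_center _).1 hg)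
      exact P.isPrime.mem_of_pow_mem n (hi (g ^ n) f hf hf0 (by simpa using hn))

end Intersection

open Polynomial

/-! ### Composite valuation rings on rational functions. -/

section Composite

variable {k : Type*} [Field k] {a : k}

/-- The rational function `f` is defined at `a`, with value `c`. -/
def HasValue (a : k) (f : RatFunc k) (c : k) : Prop :=
  ∃ p q : k[X], q.eval a ≠ 0 ∧ f = algebraMap k[X] (RatFunc k) p / algebraMap k[X] (RatFunc k) q ∧
    c = p.eval a / q.eval a

theorem algebraMap_ne_zero_of_eval {q : k[X]} (h : q.eval a ≠ 0) :
    algebraMap k[X] (RatFunc k) q ≠ 0 := by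
  apply RatFunc.algebraMap_ne_zero
  rintro rfl
  simp at h

namespace HasValue

variable {f g : RatFunc k} {c d : k}

theorem const (a c : k) : HasValue a (algebraMap k (RatFunc k) c) c :=
  ⟨C c, 1, by simp, by simp, by simp⟩

theorem zero (a : k) : HasValue a 0 0 := by
  simpa using const a 0

theorem one (a : k) : HasValue a 1 1 := by
  simpa using const a 1

theorem X_sub (a b : k) :
    HasValue a (algebraMap k[X] (RatFunc k) (X - C b)) (a - b) :=
  ⟨X - C b, 1, by simp, by simp, by simp⟩

theorem add (hf : HasValue a f c) (hg : HasValue a g d) : HasValue a (f + g) (c + d) := by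
  obtain ⟨p, q, hq, rfl, rfl⟩ := hf
  obtain ⟨p', q', hq', rfl, rfl⟩ := hg
  refine ⟨p * q' + q * p', q * q', by simp [hq, hq'], ?_, ?_⟩
  · rw [div_add_div _ _ (algebraMap_ne_zero_of_eval hq) (algebraMap_ne_zero_of_eval hq')]
    simp
  · rw [div_add_div _ _ hq hq']
    simp

theorem mul (hf : HasValue a f c) (hg : HasValue a g d) : HasValue a (f * g) (c * d) := by
  obtain ⟨p, q, hq, rfl, rfl⟩ := hf
  obtain ⟨p', q', hq', rfl, rfl⟩ := hg
  exact ⟨p * p', q * q', by simp [hq, hq'], by simp [div_mul_div_comm], by simp [div_mul_div_comm]⟩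

theorem neg (hf : HasValue a f c) : HasValue a (-f) (-c) := by
  obtain ⟨p, q, hq, rfl, rfl⟩ := hf
  exact ⟨-p, q, hq, by simp [neg_div], by simp [neg_div]⟩

theorem pow (hf : HasValue a f c) (n : ℕ) : HasValue a (f ^ n) (c ^ n) := by
  induction n with
  | zero => simpa using one a
  | succ n ih => simpa [pow_succ] using ih.mul hf

theorem inv (hf : HasValue a f c) (hc : c ≠ 0) : HasValue a f⁻¹ c⁻¹ := by
  obtain ⟨p, q, hq, rfl, rfl⟩ := hf
  refine ⟨q, p, fun h => hc (by simp [h]), by simp, by simp⟩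

theorem unique (hf : HasValue a f c) (hf' : HasValue a f d) : c = d := by
  obtain ⟨p, q, hq, rfl, rfl⟩ := hf
  obtain ⟨p', q', hq', h, rfl⟩ := hf'
  rw [div_eq_div_iff (algebraMap_ne_zero_of_eval hq) (algebraMap_ne_zero_of_eval hq'),
    ← map_mul, ← map_mul] at h
  have := congrArg (eval a) (RatFunc.algebraMap_injective k h)
  rw [div_eq_div_iff hq hq', ← eval_mul, this, eval_mul]

theorem exists_or_inv (a : k) (f : RatFunc k) : (∃ c, HasValue a f c) ∨ HasValue a f⁻¹ 0 := by
  by_cases hq : f.denom.eval a = 0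
  · right
    have hp : f.num.eval a ≠ 0 := by
      intro hp
      obtain ⟨u, v, huv⟩ := f.isCoprime_num_denom
      have := congrArg (eval a) huv
      simp [hp, hq] at this
    refine ⟨f.denom, f.num, hp, ?_, by simp [hq]⟩
    rw [← inv_div, f.num_div_denom]
  · exact .inl ⟨_, f.num, f.denom, hq, f.num_div_denom.symm, rfl⟩

theorem exists_eq_pow_mul (hf : HasValue a f c) (hf0 : f ≠ 0) :
    ∃ (n : ℕ) (g : RatFunc k) (d : k), d ≠ 0 ∧ HasValue a g d ∧
      f = algebraMap k[X] (RatFunc k) (X - C a) ^ n * g := by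
  obtain ⟨p, q, hq, rfl, -⟩ := hf
  have hp : p ≠ 0 := by
    rintro rfl
    simp at hf0
  obtain ⟨p', hp', hdvd⟩ := exists_eq_pow_rootMultiplicity_mul_and_not_dvd p hp a
  rw [dvd_iff_isRoot, IsRoot] at hdvd
  refine ⟨p.rootMultiplicity a, _, _, div_ne_zero hdvd hq, ⟨p', q, hq, rfl, rfl⟩, ?_⟩
  conv_lhs => rw [hp']
  rw [map_mul, map_pow, mul_div_assoc]

theorem exists_eq_mul (hf : HasValue a f 0) :
    ∃ (g : RatFunc k) (d : k), HasValue a g d ∧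
      f = algebraMap k[X] (RatFunc k) (X - C a) * g := by
  obtain ⟨p, q, hq, rfl, h⟩ := hf
  have hp : p.IsRoot a := by
    rw [eq_comm, div_eq_zero_iff] at h
    exact h.resolve_right hq
  obtain ⟨p', rfl⟩ := dvd_iff_isRoot.2 hp
  exact ⟨_, _, ⟨p', q, hq, rfl, rfl⟩, by rw [map_mul, mul_div_assoc]⟩

/-- A function vanishing at `a` is topologically nilpotent for the order of vanishing at `a`. -/
theorem exists_pow_div (hf : HasValue a f 0) (hg : HasValue a g d) (hg0 : g ≠ 0) :
    ∃ n : ℕ, HasValue a (f ^ n / g) 0 := by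
  obtain ⟨f', c, hf', rfl⟩ := hf.exists_eq_mul
  obtain ⟨n, g', e, he, hg', rfl⟩ := hg.exists_eq_pow_mul hg0
  -- Here n is the order of vanishing of g. The extra factor makes the quotient vanish at a, not
  -- merely be defined there.
  refine ⟨n + 1, ?_⟩
  have hX : algebraMap k[X] (RatFunc k) (X - C a) ≠ 0 :=
    RatFunc.algebraMap_ne_zero (X_sub_C_ne_zero a)
  have hg0' : g' ≠ 0 := right_ne_zero_of_mul hg0
  have h := ((X_sub a a).mul (hf'.pow (n + 1))).mul (hg'.inv he)
  rw [sub_self, zero_mul, zero_mul] at h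
  convert h using 1
  field_simp
  ring

end HasValue

/-- The valuation ring of rational functions defined at `a` with value in `W`. -/
def composite (a : k) (W : ValuationSubring k) : ValuationSubring (RatFunc k) where
  carrier := {f | ∃ c ∈ W, HasValue a f c}
  mul_mem' := fun ⟨c, hc, hf⟩ ⟨d, hd, hg⟩ => ⟨c * d, mul_mem hc hd, hf.mul hg⟩
  one_mem' := ⟨1, one_mem _, .one a⟩
  add_mem' := fun ⟨c, hc, hf⟩ ⟨d, hd, hg⟩ => ⟨c + d, add_mem hc hd, hf.add hg⟩
  zero_mem' := ⟨0, zero_mem _, .zero a⟩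
  neg_mem' := fun ⟨c, hc, hf⟩ => ⟨-c, neg_mem hc, hf.neg⟩
  mem_or_inv_mem' f := by
    rcases HasValue.exists_or_inv a f with ⟨c, hf⟩ | hf
    · rcases W.mem_or_inv_mem c with hc | hc
      · exact .inl ⟨c, hc, hf⟩
      · by_cases hc0 : c = 0
        · exact .inl ⟨c, hc0 ▸ zero_mem W, hf⟩
        · exact .inr ⟨c⁻¹, hc, hf.inv hc0⟩
    · exact .inr ⟨0, zero_mem W, hf⟩

variable {W : ValuationSubring k} {f g : RatFunc k}

theorem mem_composite : f ∈ composite a W ↔ ∃ c ∈ W, HasValue a f c := Iff.rfl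

theorem composite_mono {W' : ValuationSubring k} (h : W ≤ W') : composite a W ≤ composite a W' :=
  fun _ ⟨c, hc, hf⟩ => ⟨c, h hc, hf⟩

theorem mem_nonunits_composite :
    f ∈ (composite a W).nonunits ↔ ∃ c ∈ W.nonunits, HasValue a f c := by
  constructor
  · intro h
    obtain ⟨c, hc, hf⟩ := ValuationSubring.nonunits_le h
    refine ⟨c, ?_, hf⟩
    rw [ValuationSubring.mem_nonunits_iff_or] at h ⊢
    by_contra! hcon
    rcases h with rfl | h
    · exact hcon.1 (hf.unique (.zero a))
    · exact h ⟨c⁻¹, hcon.2, hf.inv hcon.1⟩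
  · rintro ⟨c, hc, hf⟩
    rw [ValuationSubring.mem_nonunits_iff_or] at hc ⊢
    by_cases hf0 : f = 0
    · exact .inl hf0
    right
    rintro ⟨d, hd, hf'⟩
    have h := hf.mul hf'
    rw [mul_inv_cancel₀ hf0] at h
    have hcd := h.unique (.one a)
    rcases hc with rfl | hc
    · simp at hcd
    · rw [← eq_inv_of_mul_eq_one_right hcd] at hc
      exact hc hd

theorem mem_nonunits_top {c : k} : c ∈ (⊤ : ValuationSubring k).nonunits ↔ c = 0 := by
  rw [ValuationSubring.mem_nonunits_iff_or]
  simp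

theorem mem_nonunits_composite_top :
    f ∈ (composite a ⊤).nonunits ↔ HasValue a f 0 := by
  simp [mem_nonunits_composite, mem_nonunits_top]

/-- Some power of each nonunit is divisible by any given nonzero element. -/
def IsArchimedean {k : Type*} [Field k] (W : ValuationSubring k) : Prop :=
  ∀ c ∈ W.nonunits, ∀ d ∈ W, d ≠ 0 → ∃ n : ℕ, c ^ n / d ∈ W

theorem isArchimedean_top : IsArchimedean (⊤ : ValuationSubring k) :=
  fun _ _ _ _ _ => ⟨0, trivial⟩

theorem exists_pow_div_mem_composite (hf : f ∈ (composite a ⊤).nonunits)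
    (hg : g ∈ composite a W) (hg0 : g ≠ 0) : ∃ n : ℕ, f ^ n / g ∈ composite a W := by
  obtain ⟨d, -, hg⟩ := hg
  obtain ⟨n, hn⟩ := (mem_nonunits_composite_top.1 hf).exists_pow_div hg hg0
  exact ⟨n, 0, zero_mem W, hn⟩

theorem isArchimedean_composite_top : IsArchimedean (composite a (⊤ : ValuationSubring k)) :=
  fun _ hc _ hd hd0 => exists_pow_div_mem_composite hc hd hd0

/-- Since f has a nonzero value at a, the question passes to values in the residue field k, where W
is archimedean. -/
theorem IsArchimedean.exists_pow_div_mem (hW : IsArchimedean W) (hf : f ∈ composite a W)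
    (hf' : f ∉ (composite a ⊤).nonunits) (hg : g ∈ (composite a W).nonunits) :
    ∃ n : ℕ, g ^ n / f ∈ composite a W := by
  obtain ⟨c, hc, hfc⟩ := hf
  obtain ⟨d, hd, hgd⟩ := mem_nonunits_composite.1 hg
  have hc0 : c ≠ 0 := by
    rintro rfl
    exact hf' (mem_nonunits_composite_top.2 hfc)
  obtain ⟨n, hn⟩ := hW d hd c hc hc0
  rw [div_eq_mul_inv] at hn
  refine ⟨n, d ^ n * c⁻¹, hn, ?_⟩
  rw [div_eq_mul_inv]
  exact (hgd.pow n).mul (hfc.inv hc0)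

end Composite

/-! ### Realising a finite branched poset by a Prüfer domain. -/

theorem exists_isPrufer_isBranched {F : Type u} [Field F] [Infinite F] {ι : Type*} [Finite ι]
    (S : Set ι) :
    ∃ (R : Type u) (_ : CommRing R) (_ : IsDomain R) (q m : ι → PrimeSpectrum R), IsPrufer R ∧
      IsBranched q m ∧ ∀ i, q i = m i ↔ i ∉ S := by
  classical
  let e : ι ↪ F := ((Finite.equivFin ι).toEmbedding.trans Fin.valEmbedding).trans
    (Infinite.natEmbedding F)
  let W₁ : ValuationSubring (RatFunc F) := composite 0 ⊤
  let W (i : ι) : ValuationSubring (RatFunc F) := if i ∈ S then W₁ else ⊤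
  let a (i : ι) : RatFunc F := algebraMap F (RatFunc F) (e i)
  let V (i : ι) := composite (a i) (W i)
  let O (i : ι) := composite (a i) (⊤ : ValuationSubring (RatFunc F))
  -- X - a_i vanishes at a_i, and at any other a_j takes a nonzero constant value in F, a unit of `W
  -- j`.
  let x (i : ι) : RatFunc (RatFunc F) := algebraMap (RatFunc F)[X] _ (X - C (a i))
  have hW₁ (u : F) : algebraMap F (RatFunc F) u ∈ W₁ := ⟨u, trivial, .const 0 u⟩
  have hW₁W (i) : W₁ ≤ W i := by
    by_cases hi : i ∈ S
    · simp [W, hi]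
    · simp [W, hi]
  have hVO (i) : V i ≤ O i := composite_mono le_top
  have hWa (i) : IsArchimedean (W i) := by
    by_cases hi : i ∈ S
    · simpa [W, hi] using isArchimedean_composite_top
    · simpa [W, hi] using isArchimedean_top
  have hV (i) (u : F) : algebraMap F (RatFunc (RatFunc F)) u ∈ V i := by
    rw [IsScalarTower.algebraMap_apply F (RatFunc F) (RatFunc (RatFunc F))]
    exact ⟨_, hW₁W i (hW₁ u), .const _ _⟩
  have hsub (i j) : a j - a i = algebraMap F (RatFunc F) (e j - e i) := by simp [a]
  have hbr := isBranched_center (x := x) hV hVO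
    (fun i f hf g hg hg0 => exists_pow_div_mem_composite hf hg hg0)
    (fun i f hf hf' g hg => (hWa i).exists_pow_div_mem hf hf' hg)
    (fun i => RatFunc.algebraMap_ne_zero (X_sub_C_ne_zero _))
    (fun i j => ⟨_, hW₁W j (by rw [hsub]; exact hW₁ _), .X_sub (a j) (a i)⟩)
    (fun i => mem_nonunits_composite_top.2 (by rw [← sub_self (a i)]; exact .X_sub _ _))
    (fun i j hij h => by
      obtain ⟨c, hc, hx⟩ := mem_nonunits_composite.1 h
      rw [hx.unique (.X_sub (a j) (a i)), ValuationSubring.mem_nonunits_iff_or, hsub] at hc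
      have hne : e j - e i ≠ 0 := sub_ne_zero.2 fun h => hij (e.injective h.symm)
      rcases hc with hc | hc
      · exact hne ((map_eq_zero _).1 hc)
      · apply hc
        rw [← map_inv₀]
        exact hW₁W j (hW₁ _))
  have := isBezout_interRing hV
  refine ⟨interRing V, inferInstance, inferInstance, _, _, isPrufer_of_isBezout _, hbr,
    fun i => ⟨fun h hi => ?_, fun hi => ?_⟩⟩
  -- For i in S, the element t lies in the upper center but not in the lower one, since its value at
  -- a_i is t itself, which is nonzero.
  · have ht : HasValue 0 (algebraMap F[X] (RatFunc F) (X - C 0)) 0 := by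
      simpa using HasValue.X_sub (0 : F) 0
    have htW : algebraMap F[X] (RatFunc F) (X - C 0) ∈ W₁ := ⟨0, trivial, ht⟩
    let T : interRing V := ⟨algebraMap (RatFunc F) _ (algebraMap F[X] (RatFunc F) (X - C 0)),
      mem_interRing.2 fun j => ⟨_, hW₁W j htW, .const _ _⟩⟩
    have hTm : T ∈ (center (interRing_le (V := V) i)).asIdeal := by
      refine (mem_center _).2 (mem_nonunits_composite.2 ⟨_, ?_, .const _ _⟩)
      simp only [W, if_pos hi]
      exact mem_nonunits_composite_top.2 ht
    rw [← h, mem_center] at hTm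
    have h0 := (mem_nonunits_composite_top.1 hTm).unique (.const _ _)
    exact RatFunc.algebraMap_ne_zero (X_sub_C_ne_zero (0 : F)) h0.symm
  · have hOV : O i = V i := by simp [O, V, W, hi]
    ext f
    rw [mem_center, mem_center, hOV]

end PinchedDomain

theorem mainTheorem11 (D : Type u) [CommRing D] [IsDomain D]
    (hD : PinchedDomain.IsGMPD D) (hfin : Finite (PinchedDomain.Overring D)) :
    ∃ (R : Type u) (_ : CommRing R), IsDomain R ∧ PinchedDomain.IsPrufer R ∧
      Nonempty (PrimeSpectrum D ≃o PrimeSpectrum R) := by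
  obtain ⟨q, m, hqm⟩ := hD.exists_isBranched
  have := PinchedDomain.finite_maximalSpectrum_of_finite_overring hfin
  -- Any infinite field serves as F; lifting ℚ puts R in the universe of D.
  obtain ⟨R, _, hR, q', m', hP, hqm', h⟩ :=
    PinchedDomain.exists_isPrufer_isBranched (F := ULift.{u} ℚ) {i | q i ≠ m i}
  exact ⟨R, inferInstance, hR, hP, hqm.nonempty_orderIso hqm' fun i => by simp [h]⟩
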